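/- Let $d\ge 1$ and $n_1,\dots,n_d\ge 2$, let $X=\prod_{k=1}^d \mathbb S^{n_k-1}$ be the product of the Euclidean unit spheres $\mathbb S^{n_k-1}\subset\mathbb R^{n_k}$, equipped with the sum-geodesic distance $$\operatorname{dist}_{\mathbb S}(x,y)=\sum_{k=1}^d\arccos\langle x_k,y_k\rangle,\qquad x,y\in X.$$ Let $\mathfrak F:X\to[0,\infty)$ be a random function on a probability space (so $\mathfrak F(x)$ is a random variable for every $x\in X$) which is almost surely Lipschitz with respect to $\operatorname{dist}_{\mathbb S}$, and suppose that, for some deterministic $L\ge 1$, its (least) Lipschitz constant satisfies almost surely $$\operatorname{Lip}(\mathfrak F)\le L\max_{x\in X}\mathfrak F(x).$$ Then for all $t>0$ the maximum on the right-hand side below is attained and $$\mathbb P\Big(\max_{x\in X}\mathfrak F(x)\ge t\Big)\le C(L,d;n_1,\dots,n_d)\,\max_{x\in X}\mathbb P\Big(\mathfrak F(x)\ge \frac t2\Big),\qquad(\ast)$$ where $$\ln C(L,d;n_1,\dots,n_d)=(2+\ln(dL))\sum_{k=1}^d n_k-\frac12\sum_{k=1}^d\ln(n_k-1)-d\ln(dL).$$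 Moreover, if $\mathfrak F$ is invariant in law under orthogonal changes of variables on $\mathbb S^{n_1-1},\dots,\mathbb S^{n_d-1}$ (that is, for all orthogonal transformations $g_k$ of $\mathbb R^{n_k}$ the random functions $(x_1,\dots,x_d)\mapsto\mathfrak F(g_1x_1,\dots,g_dx_d)$ and $\mathfrak F$ have the same finite-dimensional distributions), then for every $t>0$ the probability $\mathbb P(\mathfrak F(x)\ge t/2)$ does not depend on $x\in X$, and the maximum on the right-hand side of $(\ast)$ can be omitted: for every $x\in X$, $$\mathbb P\Big(\max_{y\in X}\mathfrak F(y)\ge t\Big)\le C(L,d;n_1,\dots,n_d)\,\mathbb P\Big(\mathfrak F(x)\ge \frac t2\Big).$$ -/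

import Mathlib

open MeasureTheory

noncomputable section

/-- The product of unit spheres `∏ₖ S^{n k - 1}`, where `S^{n k - 1}` is the Euclidean unit sphere
of `ℝ^{n k}`. -/
abbrev SphereProd {d : ℕ} (n : Fin d → ℕ) : Type :=
  ∀ k : Fin d, Metric.sphere (0 : EuclideanSpace ℝ (Fin (n k))) 1

namespace SphereProd

variable {d : ℕ} {n : Fin d → ℕ}

/-- The sum-geodesic distance `∑ₖ arccos ⟨xₖ, yₖ⟩`. -/
def sumGeodesicDist (x y : SphereProd n) : ℝ :=
  ∑ k, Real.arccos
    (inner ℝ (x k : EuclideanSpace ℝ (Fin (n k))) (y k : EuclideanSpace ℝ (Fin (n k))))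

/-- `K` is a Lipschitz bound of `f` for the sum-geodesic distance. -/
def IsLipBound (f : SphereProd n → ℝ) (K : ℝ) : Prop :=
  0 ≤ K ∧ ∀ x y, |f x - f y| ≤ K * sumGeodesicDist x y

/-- `f` is Lipschitz for the sum-geodesic distance. -/
def IsLip (f : SphereProd n → ℝ) : Prop :=
  ∃ K, IsLipBound f K

/-- The Lipschitz constant of a Lipschitz function `f`: the least Lipschitz bound for the
sum-geodesic distance. -/
def lipConst (f : SphereProd n → ℝ) : ℝ :=
  sInf {K | IsLipBound f K}

/-- The maximum of `f`; Lipschitz functions attain their supremum when the (compact) product of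
spheres is nonempty. -/
def maxVal (f : SphereProd n → ℝ) : ℝ :=
  ⨆ x, f x

/-- The action of a tuple of orthogonal transformations `gₖ ∈ O(n k)`, factor by factor. -/
def orthAct
    (g : ∀ k : Fin d, EuclideanSpace ℝ (Fin (n k)) ≃ₗᵢ[ℝ] EuclideanSpace ℝ (Fin (n k)))
    (x : SphereProd n) : SphereProd n :=
  fun k => ⟨g k (x k), by simp⟩

/-- The random function `F` is invariant (in law) under orthogonal changes of variables on each of
the spheres: for every tuple `g` of orthogonal transformations, the random function `F ∘ g` has the
same law as `F`. The law is the one on the space of functions with the product `σ`-algebra, so this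
says that all finite-dimensional distributions agree. -/
def IsOrthInvariant {Ω : Type*} [MeasurableSpace Ω] (P : Measure Ω)
    (F : Ω → SphereProd n → ℝ) : Prop :=
  ∀ g : ∀ k : Fin d, EuclideanSpace ℝ (Fin (n k)) ≃ₗᵢ[ℝ] EuclideanSpace ℝ (Fin (n k)),
    P.map (fun ω (x : SphereProd n) => F ω (orthAct g x)) = P.map F

/-- The constant `C(L, d; n₁, …, n_d)`, given by
`ln C = (2 + ln (d L)) ∑ₖ nₖ - (1/2) ∑ₖ ln (nₖ - 1) - d ln (d L)`. -/
def tailConst (L : ℝ) {d : ℕ} (n : Fin d → ℕ) : ℝ :=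
  Real.exp ((2 + Real.log ((d : ℝ) * L)) * (∑ k, (n k : ℝ))
    - (1 / 2 : ℝ) * (∑ k, Real.log ((n k : ℝ) - 1))
    - (d : ℝ) * Real.log ((d : ℝ) * L))

end SphereProd

end

/-! At a maximizer of a sample path, the Lipschitz bound keeps the path above half its maximum on
the ball of radius `1 / (2 * L)`. Hence a fixed `1 / (2 * L)`-net contains a point with value at
least `t / 2` whenever the maximum is at least `t`, and a union bound over the net gives the tail
estimate (`measureReal_le_maxVal_le`). The constant bounds the size of a product of nets of the
factors (`exists_net`), each estimated by comparing volumes in a thin shell. The one-point tail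
attains its maximum by upper semicontinuity and compactness. Under invariance it is constant, since
the orthogonal groups act transitively. -/

theorem pow_succ_sub_pow_succ_le {a b : ℝ} (hb : 0 ≤ b) (hab : b ≤ a) (m : ℕ) :
    a ^ (m + 1) - b ^ (m + 1) ≤ (m + 1) * (a - b) * a ^ m := by
  have ha : 0 ≤ a := hb.trans hab
  induction m with
  | zero => simp
  | succ m ih =>
    have h1 : b ^ (m + 1) ≤ a ^ (m + 1) := pow_le_pow_left₀ hb hab _
    have h2 := mul_le_mul_of_nonneg_left ih ha
    have h3 := mul_le_mul_of_nonneg_left h1 (sub_nonneg.2 hab)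
    calc a ^ (m + 1 + 1) - b ^ (m + 1 + 1)
        = a * (a ^ (m + 1) - b ^ (m + 1)) + (a - b) * b ^ (m + 1) := by ring
      _ ≤ a * ((m + 1) * (a - b) * a ^ m) + (a - b) * a ^ (m + 1) := add_le_add h2 h3
      _ = _ := by push_cast; ring

/-! ### Packing and nets on one sphere. -/

section Packing

variable {E : Type*} [NormedAddCommGroup E] [NormedSpace ℝ E] [FiniteDimensional ℝ E]

/-- A `δ`-separated subset of the unit sphere: the `δ/2`-balls around its points are disjoint and lie
in the shell `1 - δ/2 ≤ ‖x‖ ≤ 1 + δ/2`. -/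
theorem card_mul_pow_add_pow_le_of_separated_sphere
    {δ : ℝ} (hδ : 0 < δ) (hδ2 : δ < 2) (S : Finset E) (hS : ∀ x ∈ S, ‖x‖ = 1)
    (hsep : ∀ x ∈ S, ∀ y ∈ S, x ≠ y → δ ≤ dist x y) :
    S.card * (δ / 2) ^ Module.finrank ℝ E + (1 - δ / 2) ^ Module.finrank ℝ E ≤
      (1 + δ / 2) ^ Module.finrank ℝ E := by
  borelize E
  let μ : Measure E := Measure.addHaar
  have hball : ∀ (x : E) (r : ℝ), 0 < r →
      μ.real (Metric.ball x r) = r ^ Module.finrank ℝ E * μ.real (Metric.ball 0 1) := by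
    intro x r hr
    rw [measureReal_def, Measure.addHaar_ball_of_pos μ x hr, ENNReal.toReal_mul,
      ENNReal.toReal_ofReal (by positivity), measureReal_def]
  have hpos : 0 < μ.real (Metric.ball (0 : E) 1) :=
    ENNReal.toReal_pos (Metric.measure_ball_pos μ _ one_pos).ne' measure_ball_lt_top.ne
  have hU : μ.real (⋃ x ∈ S, Metric.ball x (δ / 2)) = S.card * (δ / 2) ^ Module.finrank ℝ E *
      μ.real (Metric.ball 0 1) := by
    rw [measureReal_biUnion_finset _ (fun _ _ => measurableSet_ball)
      (fun _ _ => measure_ball_lt_top.ne)]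
    · rw [Finset.sum_congr rfl fun x _ => hball x (δ / 2) (by positivity)]
      simp [mul_assoc]
    · intro x hx y hy hxy
      exact Metric.ball_disjoint_ball (by have := hsep x hx y hy hxy; linarith)
  have hdisj : Disjoint (⋃ x ∈ S, Metric.ball x (δ / 2)) (Metric.ball (0 : E) (1 - δ / 2)) := by
    simp only [Set.disjoint_iUnion_left]
    intro x hx
    refine Metric.ball_disjoint_ball ?_
    rw [dist_zero_right, hS x hx]; linarith
  have hsub : (⋃ x ∈ S, Metric.ball x (δ / 2)) ∪ Metric.ball (0 : E) (1 - δ / 2) ⊆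
      Metric.ball (0 : E) (1 + δ / 2) := by
    refine Set.union_subset (Set.iUnion₂_subset fun x hx => ?_)
      (Metric.ball_subset_ball (by linarith))
    refine Metric.ball_subset_ball' ?_
    rw [dist_zero_right, hS x hx]; linarith
  have h := measureReal_mono (μ := μ) hsub measure_ball_lt_top.ne
  rw [measureReal_union hdisj measurableSet_ball
    ((measure_mono (Set.subset_union_left.trans hsub)).trans_lt measure_ball_lt_top).ne
    measure_ball_lt_top.ne, hU, hball _ (1 - δ / 2) (by linarith),
    hball _ (1 + δ / 2) (by linarith), ← add_mul] at h
  exact le_of_mul_le_mul_right h hpos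

/-- The shell has thickness `δ`, so its volume carries a factor `δ` that cancels one power of `1 /
δ`. The resulting exponent `m`, not `m + 1`, accounts for the term `- d * log (d * L)` in the
constant. -/
theorem card_le_of_separated_sphere {m : ℕ} (hm : Module.finrank ℝ E = m + 1)
    {δ : ℝ} (hδ : 0 < δ) (hδ2 : δ < 2) (S : Finset E) (hS : ∀ x ∈ S, ‖x‖ = 1)
    (hsep : ∀ x ∈ S, ∀ y ∈ S, x ≠ y → δ ≤ dist x y) :
    (S.card : ℝ) ≤ 2 * (m + 1) * (1 + 2 / δ) ^ m := by
  have h := card_mul_pow_add_pow_le_of_separated_sphere hδ hδ2 S hS hsep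
  rw [hm] at h
  have h2 := pow_succ_sub_pow_succ_le (a := 1 + δ / 2) (b := 1 - δ / 2) (by linarith)
    (by linarith) m
  have h3 : (1 + δ / 2) = (1 + 2 / δ) * (δ / 2) := by field_simp; ring
  have h4 : (S.card : ℝ) * (δ / 2) ^ (m + 1) ≤
      (2 * (m + 1) * (1 + 2 / δ) ^ m) * (δ / 2) ^ (m + 1) := by
    calc (S.card : ℝ) * (δ / 2) ^ (m + 1)
        ≤ (m + 1) * ((1 + δ / 2) - (1 - δ / 2)) * (1 + δ / 2) ^ m := by linarith
      _ = (m + 1) * δ * ((1 + 2 / δ) * (δ / 2)) ^ m := by rw [← h3]; ring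
      _ = _ := by rw [mul_pow]; ring
  exact le_of_mul_le_mul_right h4 (by positivity)

/-- The unit sphere has a `δ`-net with at most `2 (m + 1) (1 + 2 / δ) ^ m` points in
dimension `m + 1`. -/
theorem exists_net_sphere {m : ℕ} (hm : Module.finrank ℝ E = m + 1)
    {δ : ℝ} (hδ : 0 < δ) (hδ2 : δ < 2) :
    ∃ S : Finset (Metric.sphere (0 : E) 1),
      (S.card : ℝ) ≤ 2 * (m + 1) * (1 + 2 / δ) ^ m ∧ ∀ x, ∃ y ∈ S, dist x y < δ := by
  classical
  -- A separated set of maximal cardinality is a net: an uncovered point could be added to it.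
  let T : Set ℕ := {c | ∃ S : Finset (Metric.sphere (0 : E) 1),
    (∀ x ∈ S, ∀ y ∈ S, x ≠ y → δ ≤ dist x y) ∧ S.card = c}
  have hcard : ∀ S : Finset (Metric.sphere (0 : E) 1),
      (∀ x ∈ S, ∀ y ∈ S, x ≠ y → δ ≤ dist x y) →
      (S.card : ℝ) ≤ 2 * (m + 1) * (1 + 2 / δ) ^ m := by
    intro S hS
    have := card_le_of_separated_sphere hm hδ hδ2 (S.map (Function.Embedding.subtype _))
      (by simp +contextual) (by
        simp only [Finset.mem_map, Function.Embedding.subtype_apply]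
        rintro _ ⟨x, hx, rfl⟩ _ ⟨y, hy, rfl⟩ hxy
        exact hS x hx y hy fun h => hxy (by rw [h]))
    simpa using this
  have hbdd : BddAbove T := by
    refine ⟨⌊2 * (m + 1) * (1 + 2 / δ) ^ m⌋₊, ?_⟩
    rintro c ⟨S, hS, rfl⟩
    exact Nat.le_floor (hcard S hS)
  obtain ⟨S, hS, hSc⟩ := Nat.sSup_mem (s := T) ⟨0, ∅, by simp⟩ hbdd
  refine ⟨S, hcard S hS, fun x => ?_⟩
  by_contra! hx
  have hxS : x ∉ S := fun h => by simpa [hδ.not_ge] using hx x h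
  have hmem : (insert x S).card ∈ T := by
    refine ⟨insert x S, ?_, rfl⟩
    intro y hy z hz hyz
    rcases Finset.mem_insert.1 hy with hy' | hy' <;> rcases Finset.mem_insert.1 hz with hz' | hz'
    · exact absurd (hy'.trans hz'.symm) hyz
    · exact hy' ▸ hx z hz'
    · rw [dist_comm]; exact hz' ▸ hx y hy'
    · exact hS y hy' z hz' hyz
  have := le_csSup hbdd hmem
  rw [Finset.card_insert_of_notMem hxS, ← hSc] at this
  omega

end Packing

/-! ### Chords versus angles, and numerical estimates. -/

/-- Chordal distance `0.98 θ` forces angle at most `θ`, for small `θ`. -/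
theorem arccos_inner_le_of_dist_le {E : Type*} [NormedAddCommGroup E] [InnerProductSpace ℝ E]
    {x y : E} (hx : ‖x‖ = 1) (hy : ‖y‖ = 1) {θ : ℝ} (hθ : 0 ≤ θ) (hθ2 : θ ≤ 1 / 2)
    (h : dist x y ≤ 0.98 * θ) : Real.arccos (inner ℝ x y) ≤ θ := by
  have h1 : ‖x - y‖ ^ 2 ≤ (0.98 * θ) ^ 2 := by
    rw [dist_eq_norm] at h
    exact pow_le_pow_left₀ (norm_nonneg _) h 2
  rw [norm_sub_sq_real, hx, hy] at h1
  -- The slack in `0.98` absorbs the fourth-order error of the cosine.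
  have h2 := (abs_le.1 (Real.cos_bound (x := θ) (by rw [abs_of_nonneg hθ]; linarith))).2
  rw [abs_of_nonneg hθ] at h2
  have h3 : θ ^ 4 ≤ θ ^ 2 * (1 / 2) ^ 2 := by
    rw [show θ ^ 4 = θ ^ 2 * θ ^ 2 by ring]
    gcongr
  have h4 : Real.cos θ ≤ inner ℝ x y := by nlinarith [sq_nonneg θ]
  calc Real.arccos (inner ℝ x y) ≤ Real.arccos (Real.cos θ) := Real.arccos_le_arccos h4
    _ = θ := Real.arccos_cos hθ (by linarith [Real.pi_gt_three])

theorem two_mul_succ_mul_sqrt_mul_pow_le {m : ℕ} (hm : 1 ≤ m) :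
    2 * ((m : ℝ) + 1) * Real.sqrt m * (5.09 : ℝ) ^ m ≤ Real.exp (2 * ((m : ℝ) + 1)) := by
  -- Tangent line of the square root at `4`.
  have hsqrt : Real.sqrt m ≤ ((m : ℝ) + 4) / 4 := by
    rw [Real.sqrt_le_left (by positivity)]
    nlinarith [sq_nonneg ((m : ℝ) - 4)]
  have hpoly : ∀ k : ℕ, 1 ≤ k →
      ((k : ℝ) + 1) * ((k + 4) / 2) * (5.09 : ℝ) ^ k ≤ (7.38 : ℝ) ^ (k + 1) := by
    intro k hk
    induction k, hk using Nat.le_induction with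
    | base => norm_num
    | succ k hk ih =>
      -- The ratio of consecutive left sides is at most `7.38` only from `k = 3` on.
      rcases (show k = 1 ∨ k = 2 ∨ 3 ≤ k by omega) with rfl | rfl | hk3
      · norm_num
      · norm_num
      · have hk' : (3 : ℝ) ≤ k := by exact_mod_cast hk3
        have h5 : (0 : ℝ) < 5.09 ^ k := by positivity
        have hq : ((k : ℝ) + 2) * ((k + 5) / 2) * 5.09 ≤ 7.38 * (((k : ℝ) + 1) * ((k + 4) / 2)) := by
          nlinarith
        calc (((k + 1 : ℕ) : ℝ) + 1) * ((((k + 1 : ℕ) : ℝ) + 4) / 2) * (5.09 : ℝ) ^ (k + 1)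
            = (((k : ℝ) + 2) * ((k + 5) / 2) * 5.09) * 5.09 ^ k := by push_cast; ring
          _ ≤ (7.38 * (((k : ℝ) + 1) * ((k + 4) / 2))) * 5.09 ^ k := by gcongr
          _ = 7.38 * (((k : ℝ) + 1) * ((k + 4) / 2) * 5.09 ^ k) := by ring
          _ ≤ 7.38 * 7.38 ^ (k + 1) := by gcongr
          _ = _ := by ring
  have hexp : (7.38 : ℝ) ≤ Real.exp 2 := by
    have := Real.exp_one_gt_d9
    rw [show (2 : ℝ) = 1 + 1 by norm_num, Real.exp_add]
    nlinarith
  calc 2 * ((m : ℝ) + 1) * Real.sqrt m * (5.09 : ℝ) ^ m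
      ≤ 2 * ((m : ℝ) + 1) * (((m : ℝ) + 4) / 4) * (5.09 : ℝ) ^ m := by gcongr
    _ = ((m : ℝ) + 1) * ((m + 4) / 2) * (5.09 : ℝ) ^ m := by ring
    _ ≤ (7.38 : ℝ) ^ (m + 1) := hpoly m hm
    _ ≤ Real.exp 2 ^ (m + 1) := by gcongr
    _ = Real.exp (2 * ((m : ℝ) + 1)) := by rw [← Real.exp_nat_mul]; push_cast; ring_nf

theorem two_mul_succ_mul_pow_le_exp {m : ℕ} (hm : 1 ≤ m) {a : ℝ} (ha : 1 ≤ a) :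
    2 * ((m : ℝ) + 1) * (1 + 2 / (0.98 * (1 / (2 * a)))) ^ m ≤
      Real.exp ((2 + Real.log a) * ((m : ℝ) + 1) - 1 / 2 * Real.log m - Real.log a) := by
  have ha0 : 0 < a := by linarith
  have hm0 : (0 : ℝ) < m := by exact_mod_cast hm
  -- `1 ≤ a` and `1 + 4 / 0.98 < 5.09`.
  have h1 : 1 + 2 / (0.98 * (1 / (2 * a))) ≤ 5.09 * a := by
    have : 2 / (0.98 * (1 / (2 * a))) = 4 / 0.98 * a := by field_simp; norm_num
    rw [this]
    norm_num
    linarith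
  have h2 : Real.exp ((2 + Real.log a) * ((m : ℝ) + 1) - 1 / 2 * Real.log m - Real.log a) =
      Real.exp (2 * ((m : ℝ) + 1)) * a ^ m / Real.sqrt m := by
    rw [Real.sqrt_eq_rpow, Real.rpow_def_of_pos hm0, ← Real.exp_log (pow_pos ha0 m),
      ← Real.exp_add, ← Real.exp_sub, Real.log_pow]
    ring_nf
  rw [h2, le_div_iff₀ (Real.sqrt_pos.2 hm0)]
  calc 2 * ((m : ℝ) + 1) * (1 + 2 / (0.98 * (1 / (2 * a)))) ^ m * Real.sqrt m
      ≤ 2 * ((m : ℝ) + 1) * (5.09 * a) ^ m * Real.sqrt m := by gcongr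
    _ = (2 * ((m : ℝ) + 1) * Real.sqrt m * (5.09 : ℝ) ^ m) * a ^ m := by rw [mul_pow]; ring
    _ ≤ _ := by gcongr; exact two_mul_succ_mul_sqrt_mul_pow_le hm

/-! ### Lipschitz functions and nets on the product. -/

namespace SphereProd

variable {d : ℕ} {n : Fin d → ℕ}

theorem sumGeodesicDist_self (x : SphereProd n) : sumGeodesicDist x x = 0 := by
  simp [sumGeodesicDist]

theorem sumGeodesicDist_nonneg (x y : SphereProd n) : 0 ≤ sumGeodesicDist x y :=
  Finset.sum_nonneg fun _ _ => Real.arccos_nonneg _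

theorem continuous_sumGeodesicDist (x : SphereProd n) :
    Continuous fun y : SphereProd n => sumGeodesicDist y x := by
  unfold sumGeodesicDist
  refine continuous_finsetSum _ fun k _ => Real.continuous_arccos.comp ?_
  fun_prop

theorem nonempty_of_two_le (hn : ∀ k, 2 ≤ n k) : Nonempty (SphereProd n) := by
  refine ⟨fun k => ⟨EuclideanSpace.single ⟨0, by have := hn k; omega⟩ 1, by simp⟩⟩

theorem IsLip.isLipBound_lipConst {f : SphereProd n → ℝ} (hf : IsLip f) :
    IsLipBound f (lipConst f) := by
  refine ⟨le_csInf hf fun K hK => hK.1, fun x y => ?_⟩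
  rcases (sumGeodesicDist_nonneg x y).eq_or_lt with h | h
  · obtain ⟨K, hK⟩ := hf
    simpa [← h] using hK.2 x y
  · rw [← div_le_iff₀ h]
    exact le_csInf hf fun K hK => (div_le_iff₀ h).2 (hK.2 x y)

theorem IsLip.continuous {f : SphereProd n → ℝ} (hf : IsLip f) : Continuous f := by
  obtain ⟨K, hK⟩ := hf
  refine continuous_iff_continuousAt.2 fun x => ?_
  refine tendsto_iff_dist_tendsto_zero.2 ?_
  have h : Filter.Tendsto (fun y => K * sumGeodesicDist y x) (nhds x) (nhds 0) := by
    have := ((continuous_sumGeodesicDist x).const_mul K).tendsto x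
    simpa [sumGeodesicDist_self] using this
  exact squeeze_zero (fun _ => dist_nonneg) (fun y => hK.2 y x) h

theorem IsLip.exists_eq_maxVal [Nonempty (SphereProd n)] {f : SphereProd n → ℝ} (hf : IsLip f) :
    ∃ x, f x = maxVal f := by
  obtain ⟨x, -, hx⟩ := isCompact_univ.exists_isMaxOn Set.univ_nonempty hf.continuous.continuousOn
  refine ⟨x, le_antisymm (le_ciSup (f := f) ⟨f x, ?_⟩ x) (ciSup_le fun y => hx (Set.mem_univ y))⟩
  rintro _ ⟨y, rfl⟩
  exact hx (Set.mem_univ y)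

/-- If the Lipschitz constant is at most `L` times the maximum, then the function is at least half
of its maximum on a ball of radius `1 / (2 L)`. -/
theorem IsLip.exists_forall_half_maxVal_le [Nonempty (SphereProd n)] {f : SphereProd n → ℝ}
    (hf : IsLip f) (hf0 : 0 ≤ maxVal f) {L : ℝ} (hL : 0 < L) (hfL : lipConst f ≤ L * maxVal f) :
    ∃ x, ∀ y, sumGeodesicDist x y ≤ 1 / (2 * L) → maxVal f / 2 ≤ f y := by
  obtain ⟨x, hx⟩ := hf.exists_eq_maxVal
  refine ⟨x, fun y hy => ?_⟩
  have h := (le_abs_self _).trans (hf.isLipBound_lipConst.2 x y)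
  have h2 : lipConst f * sumGeodesicDist x y ≤ (L * maxVal f) * (1 / (2 * L)) :=
    mul_le_mul hfL hy (sumGeodesicDist_nonneg x y) (by positivity)
  have h3 : (L * maxVal f) * (1 / (2 * L)) = maxVal f / 2 := by field_simp
  linarith

theorem tailConst_eq_prod (L : ℝ) (n : Fin d → ℕ) :
    tailConst L n = ∏ k, Real.exp ((2 + Real.log (d * L)) * (n k : ℝ)
      - 1 / 2 * Real.log ((n k : ℝ) - 1) - Real.log (d * L)) := by
  rw [← Real.exp_sum, tailConst]
  simp [Finset.sum_sub_distrib, Finset.mul_sum]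

/-- The product of spheres has a `1 / (2 L)`-net of cardinality at most `tailConst L n`. -/
theorem exists_net (hd : 1 ≤ d) (hn : ∀ k, 2 ≤ n k) {L : ℝ} (hL : 1 ≤ L) :
    ∃ S : Finset (SphereProd n), (S.card : ℝ) ≤ tailConst L n ∧
      ∀ x, ∃ y ∈ S, sumGeodesicDist x y ≤ 1 / (2 * L) := by
  have hd' : (1 : ℝ) ≤ d := by exact_mod_cast hd
  have ha : 1 ≤ d * L := by nlinarith
  -- The `d` angular errors `θ` add up to `1 / (2 * L)`.
  set θ : ℝ := 1 / (2 * (d * L)) with hθ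
  have hθ0 : 0 < θ := by positivity
  have hθ2 : θ ≤ 1 / 2 := by
    rw [hθ]
    exact one_div_le_one_div_of_le (by norm_num) (by linarith)
  have hfac : ∀ k, ∃ S : Finset (Metric.sphere (0 : EuclideanSpace ℝ (Fin (n k))) 1),
      (S.card : ℝ) ≤ Real.exp ((2 + Real.log (d * L)) * (n k : ℝ)
        - 1 / 2 * Real.log ((n k : ℝ) - 1) - Real.log (d * L)) ∧
      ∀ x, ∃ y ∈ S, dist x y < 0.98 * θ := by
    intro k
    obtain ⟨m, hm⟩ : ∃ m, n k = m + 1 := ⟨n k - 1, by have := hn k; omega⟩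
    have hm1 : 1 ≤ m := by have := hn k; omega
    obtain ⟨S, hS, hS'⟩ := exists_net_sphere (E := EuclideanSpace ℝ (Fin (n k))) (m := m)
      (by simp [hm]) (δ := 0.98 * θ) (by positivity) (by linarith)
    refine ⟨S, (hS.trans (two_mul_succ_mul_pow_le_exp hm1 ha)).trans_eq ?_, hS'⟩
    rw [hm]
    push_cast
    ring_nf
  choose S hS hS' using hfac
  refine ⟨Fintype.piFinset S, ?_, fun x => ?_⟩
  · rw [tailConst_eq_prod, Fintype.card_piFinset]
    push_cast
    exact Finset.prod_le_prod (fun _ _ => by positivity) fun k _ => hS k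
  · choose y hy hy' using fun k => hS' k (x k)
    refine ⟨y, Fintype.mem_piFinset.2 hy, ?_⟩
    calc sumGeodesicDist x y ≤ ∑ _k : Fin d, θ :=
          Finset.sum_le_sum fun k _ => arccos_inner_le_of_dist_le (by simp) (by simp) hθ0.le hθ2
            (hy' k).le
      _ = 1 / (2 * L) := by simp [hθ]; field_simp

/-! ### Tail probabilities. -/

section Random

variable {Ω : Type*} [MeasurableSpace Ω] {P : Measure Ω} {F : Ω → SphereProd n → ℝ}

/-- If `F ω x < s`, continuity keeps `F ω y < s` for `y` near `x`. So the probability gained in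
passing from `x` to `y` tends to zero, and the tail is upper semicontinuous on a compact space. -/
theorem exists_forall_measureReal_le [IsProbabilityMeasure P] [Nonempty (SphereProd n)]
    (hF_meas : ∀ x, Measurable fun ω => F ω x) (hF : ∀ᵐ ω ∂P, Continuous (F ω)) (s : ℝ) :
    ∃ x₀, ∀ x, P.real {ω | s ≤ F ω x} ≤ P.real {ω | s ≤ F ω x₀} := by
  have hmeas : ∀ x, MeasurableSet {ω | s ≤ F ω x} := fun x =>
    measurableSet_le measurable_const (hF_meas x)
  have husc : UpperSemicontinuous fun x => P.real {ω | s ≤ F ω x} := by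
    intro x b hb
    have hlim : Filter.Tendsto (fun y => P ({ω | s ≤ F ω y} \ {ω | s ≤ F ω x})) (nhds x)
        (nhds (P ∅)) := by
      refine tendsto_measure_of_ae_tendsto_indicator_of_isFiniteMeasure _ MeasurableSet.empty
        (fun y => (hmeas y).diff (hmeas x)) ?_
      filter_upwards [hF] with ω hω
      rcases le_or_gt s (F ω x) with h | h
      · exact Filter.Eventually.of_forall fun y => by simp [h]
      · filter_upwards [hω.continuousAt.eventually_lt_const h] with y hy
        simp [hy]
    have hlim' : Filter.Tendsto (fun y => P.real {ω | s ≤ F ω x} +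
        P.real ({ω | s ≤ F ω y} \ {ω | s ≤ F ω x})) (nhds x) (nhds (P.real {ω | s ≤ F ω x})) := by
      have := (ENNReal.tendsto_toReal (measure_ne_top P ∅)).comp hlim
      simpa [Function.comp_def, measureReal_def] using
        this.const_add (P.real {ω | s ≤ F ω x})
    filter_upwards [hlim'.eventually_lt_const hb] with y hy
    refine lt_of_le_of_lt ?_ hy
    refine (measureReal_mono ?_).trans (measureReal_union_le _ _)
    rw [Set.union_sdiff_self]
    exact Set.subset_union_right
  obtain ⟨x₀, -, hx₀⟩ := (husc.upperSemicontinuousOn Set.univ).exists_isMaxOn Set.univ_nonempty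
    isCompact_univ
  exact ⟨x₀, fun x => hx₀ (Set.mem_univ x)⟩

/-- Union bound over a net: any bound on the one-point tails at level `t / 2` gives one on the tail of
the maximum at level `t`. -/
theorem measureReal_le_maxVal_le [IsProbabilityMeasure P] (hd : 1 ≤ d) (hn : ∀ k, 2 ≤ n k)
    (hF_lip : ∀ᵐ ω ∂P, IsLip (F ω)) {L : ℝ} (hL : 1 ≤ L)
    (hF_const : ∀ᵐ ω ∂P, lipConst (F ω) ≤ L * maxVal (F ω)) {t : ℝ} (ht : 0 < t) {p : ℝ}
    (hp : ∀ x, P.real {ω | t / 2 ≤ F ω x} ≤ p) :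
    P.real {ω | t ≤ maxVal (F ω)} ≤ tailConst L n * p := by
  have := nonempty_of_two_le hn
  obtain ⟨S, hS, hnet⟩ := exists_net hd hn hL
  have hp0 : 0 ≤ p := measureReal_nonneg.trans (hp (Classical.arbitrary _))
  have hsub : {ω | t ≤ maxVal (F ω)} ≤ᵐ[P] (⋃ y ∈ S, {ω | t / 2 ≤ F ω y} : Set Ω) := by
    filter_upwards [hF_lip, hF_const] with ω hω hωL
    intro (hmax : t ≤ maxVal (F ω))
    obtain ⟨x, hx⟩ := hω.exists_forall_half_maxVal_le (ht.le.trans hmax) (by linarith) hωL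
    obtain ⟨y, hyS, hy⟩ := hnet x
    exact Set.mem_iUnion₂.2 ⟨y, hyS, (by linarith [hx y hy] : t / 2 ≤ F ω y)⟩
  calc P.real {ω | t ≤ maxVal (F ω)}
      ≤ P.real (⋃ y ∈ S, {ω | t / 2 ≤ F ω y}) :=
        ENNReal.toReal_mono (measure_ne_top _ _) (measure_mono_ae hsub)
    _ ≤ ∑ y ∈ S, P.real {ω | t / 2 ≤ F ω y} := measureReal_biUnion_finset_le _ _
    _ ≤ ∑ _y ∈ S, p := Finset.sum_le_sum fun y _ => hp y
    _ = S.card * p := by simp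
    _ ≤ tailConst L n * p := by gcongr

theorem exists_orthAct_eq (x y : SphereProd n) : ∃ g, orthAct g x = y := by
  have h : ∀ k, ∃ g : EuclideanSpace ℝ (Fin (n k)) ≃ₗᵢ[ℝ] EuclideanSpace ℝ (Fin (n k)),
      g (x k) = y k := fun k =>
    -- Reflection in the hyperplane orthogonal to `x k - y k`.
    ⟨_, Submodule.reflection_sub
      ((norm_eq_of_mem_sphere (x k)).trans (norm_eq_of_mem_sphere (y k)).symm)⟩
  choose g hg using h
  exact ⟨g, funext fun k => Subtype.ext (hg k)⟩

theorem IsOrthInvariant.measureReal_eq (hF : IsOrthInvariant P F)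
    (hF_meas : ∀ x, Measurable fun ω => F ω x) (s : ℝ) (x y : SphereProd n) :
    P.real {ω | s ≤ F ω x} = P.real {ω | s ≤ F ω y} := by
  obtain ⟨g, rfl⟩ := exists_orthAct_eq x y
  have hset : MeasurableSet {f : SphereProd n → ℝ | s ≤ f x} :=
    measurableSet_le measurable_const (measurable_pi_apply x)
  have h := congrArg (fun μ : Measure (SphereProd n → ℝ) => μ {f | s ≤ f x}) (hF g)
  rw [Measure.map_apply (measurable_pi_lambda _ fun z => hF_meas _) hset,
    Measure.map_apply (measurable_pi_lambda _ hF_meas) hset] at h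
  exact congrArg ENNReal.toReal h.symm

end Random

end SphereProd

theorem theorem3p6 {Ω : Type*} [MeasurableSpace Ω] (P : Measure Ω) [IsProbabilityMeasure P]
    (d : ℕ) (hd : 1 ≤ d) (n : Fin d → ℕ) (hn : ∀ k, 2 ≤ n k)
    (F : Ω → SphereProd n → ℝ)
    (hF_meas : ∀ x, Measurable fun ω => F ω x)
    (hF_nonneg : ∀ ω x, 0 ≤ F ω x)
    (hF_lip : ∀ᵐ ω ∂P, SphereProd.IsLip (F ω))
    (L : ℝ) (hL : 1 ≤ L)
    (hF_const : ∀ᵐ ω ∂P, SphereProd.lipConst (F ω) ≤ L * SphereProd.maxVal (F ω)) :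
    (∀ t : ℝ, 0 < t → ∃ x₀ : SphereProd n,
      (∀ x, P.real {ω | t / 2 ≤ F ω x} ≤ P.real {ω | t / 2 ≤ F ω x₀}) ∧
      P.real {ω | t ≤ SphereProd.maxVal (F ω)} ≤
        SphereProd.tailConst L n * P.real {ω | t / 2 ≤ F ω x₀}) ∧
    (SphereProd.IsOrthInvariant P F → ∀ t : ℝ, 0 < t →
      (∀ x y, P.real {ω | t / 2 ≤ F ω x} = P.real {ω | t / 2 ≤ F ω y}) ∧
      ∀ x, P.real {ω | t ≤ SphereProd.maxVal (F ω)} ≤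
        SphereProd.tailConst L n * P.real {ω | t / 2 ≤ F ω x}) := by
  have := SphereProd.nonempty_of_two_le hn
  refine ⟨fun t ht => ?_, fun hinv t ht => ?_⟩
  · obtain ⟨x₀, hx₀⟩ := SphereProd.exists_forall_measureReal_le hF_meas
      (hF_lip.mono fun ω hω => hω.continuous) (t / 2)
    exact ⟨x₀, hx₀, SphereProd.measureReal_le_maxVal_le hd hn hF_lip hL hF_const ht hx₀⟩
  · have heq := hinv.measureReal_eq hF_meas (t / 2)
    exact ⟨heq, fun x => SphereProd.measureReal_le_maxVal_le hd hn hF_lip hL hF_const ht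
      fun y => (heq y x).le⟩
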